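/- Let $K$ be a field, let $1\le n<r$ be integers, let $R=K[x_1,\dots,x_r]$ with the standard grading, and let $J\subset R$ be the ideal generated by the products $x_ix_j$ with $1\le i,j\le n$ together with the products $x_ix_k$ with $1\le i\le n<k\le r$. Denote by $\beta_{i,j}=\dim_K[\operatorname{Tor}_i^R(R/J,K)]_j$ the graded Betti numbers of $R/J$. Then these products form a minimal set of generators of $J$, and $R/J$ has a linear resolution, that is, its minimal graded free resolution has the form $$\cdots\to R(-4)^{\beta_{3,4}}\to R(-3)^{\beta_{2,3}}\to R(-2)^{\beta_{1,2}}\to R\to R/J\to 0 .$$ Moreover $\beta_{0,0}=1$, for all $i\ge 0$ $$\beta_{i,i+1}= i\binom{n+1}{i+1} + n\left( \binom{r}{i} - \binom{n}{i}\right),$$ and $\beta_{i,j}=0$ whenever $j\ne i+1$ and $(i,j)\ne(0,0)$. (In particular $\beta_{i,i+1}=0$ for $i=0$ and for $i>r$.) -/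

import Mathlib

noncomputable section

/-- The component `R_j` of the standard graded polynomial ring `R = K[x_1, …, x_r]`, for every
integer `j`: the homogeneous forms of degree `j` together with `0`; it is zero for `j < 0`. -/
def gradedPart (K : Type*) [Field K] (r : ℕ) (j : ℤ) : Submodule K (MvPolynomial (Fin r) K) :=
  if 0 ≤ j then MvPolynomial.homogeneousSubmodule (Fin r) K j.toNat else ⊥

/-- A graded free resolution
`⋯ → F_2 → F_1 → F_0 → R/I → 0` of `R/I` over `R = K[x_1, …, x_r]`,
by finitely generated graded free modules `F_i = ⨁_a R(-deg i a)`, where `a` runs over the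
chosen homogeneous basis of `F_i`. All maps are homogeneous of degree `0`. -/
structure GradedFreeResolution {K : Type*} [Field K] {r : ℕ}
    (I : Ideal (MvPolynomial (Fin r) K)) where
  /-- the rank of `F_i` -/
  rank : ℕ → ℕ
  /-- the degrees of the basis elements of `F_i` -/
  deg : (i : ℕ) → Fin (rank i) → ℤ
  /-- the differential `F_{i+1} → F_i` -/
  d : (i : ℕ) → (Fin (rank (i + 1)) → MvPolynomial (Fin r) K) →ₗ[MvPolynomial (Fin r) K]
    (Fin (rank i) → MvPolynomial (Fin r) K)
  /-- the augmentation `F_0 → R/I` -/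
  ε : (Fin (rank 0) → MvPolynomial (Fin r) K) →ₗ[MvPolynomial (Fin r) K]
    (MvPolynomial (Fin r) K ⧸ I)
  d_homogeneous : ∀ i a b, d i (Pi.single a 1) b ∈ gradedPart K r (deg (i + 1) a - deg i b)
  ε_homogeneous : ∀ a, ∃ p ∈ gradedPart K r (deg 0 a), ε (Pi.single a 1) = Ideal.Quotient.mk I p
  ε_surjective : Function.Surjective ε
  exact_zero : Function.Exact (d 0) ε
  exact_succ : ∀ i, Function.Exact (d (i + 1)) (d i)

namespace GradedFreeResolution

variable {K : Type*} [Field K] {r : ℕ} {I : Ideal (MvPolynomial (Fin r) K)}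

/-- The resolution is minimal: every `F_{i+1} → F_i` has image in `𝔪 F_i`, where
`𝔪 = (x_1, …, x_r)`, that is, its matrix has no entry with a nonzero constant term. -/
def IsMinimal (F : GradedFreeResolution I) : Prop :=
  ∀ i a b, MvPolynomial.constantCoeff (F.d i (Pi.single a 1) b) = 0

/-- The differential `F_{i+1} ⊗_R K → F_i ⊗_R K`, where `K = R/𝔪`. In the induced bases its
matrix consists of the constant terms of the entries of the matrix of `F_{i+1} → F_i`. -/
def dBar (F : GradedFreeResolution I) (i : ℕ) : (Fin (F.rank (i + 1)) → K) →ₗ[K]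
    (Fin (F.rank i) → K) :=
  Matrix.mulVecLin
    (Matrix.of fun b a => MvPolynomial.constantCoeff (F.d i (Pi.single a 1) b))

/-- The component of degree `j` of `F_i ⊗_R K = ⨁_a K(-deg i a)`. -/
def degreePart (F : GradedFreeResolution I) (i : ℕ) (j : ℤ) :
    Submodule K (Fin (F.rank i) → K) where
  carrier := {v | ∀ a, F.deg i a ≠ j → v a = 0}
  add_mem' := fun hv hw a ha => by simp [hv a ha, hw a ha]
  zero_mem' := fun _ _ => rfl
  smul_mem' := fun c v hv a ha => by simp [hv a ha]

/-- The kernel of the differential that leaves `F_i ⊗_R K` (everything if `i = 0`). -/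
def kerBar (F : GradedFreeResolution I) : (i : ℕ) → Submodule K (Fin (F.rank i) → K)
  | 0 => ⊤
  | i + 1 => LinearMap.ker (F.dBar i)

/-- The cycles of degree `j` in `F_i ⊗_R K`. -/
def cycles (F : GradedFreeResolution I) (i : ℕ) (j : ℤ) : Submodule K (Fin (F.rank i) → K) :=
  F.degreePart i j ⊓ F.kerBar i

/-- The boundaries of degree `j` in `F_i ⊗_R K`. -/
def boundaries (F : GradedFreeResolution I) (i : ℕ) (j : ℤ) :
    Submodule K (Fin (F.rank i) → K) :=
  (F.degreePart (i + 1) j).map (F.dBar i)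

/-- The graded component `[Tor_i^R(R/I, K)]_j`, computed with the resolution `F`: the homology
of the complex `F ⊗_R K` at `F_i ⊗_R K` in degree `j`. -/
abbrev Tor (F : GradedFreeResolution I) (i : ℕ) (j : ℤ) : Type _ :=
  F.cycles i j ⧸ (F.boundaries i j).submoduleOf (F.cycles i j)

end GradedFreeResolution

/-- The `β i j` are the graded Betti numbers of `R/I`: `β i j = dim_K [Tor_i^R(R/I, K)]_j`, where
`Tor` may be computed with any graded free resolution of `R/I`, and there is one. -/
def AreGradedBettiNumbers {K : Type*} [Field K] {r : ℕ} (I : Ideal (MvPolynomial (Fin r) K))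
    (β : ℕ → ℤ → ℕ) : Prop :=
  Nonempty (GradedFreeResolution I) ∧
    ∀ (F : GradedFreeResolution I) (i : ℕ) (j : ℤ), Module.finrank K (F.Tor i j) = β i j

/-- `R/I` has a linear resolution, where `I` is generated in degree `t`: its minimal graded free
resolution has the form
`⋯ → R(-t-2)^{b_3} → R(-t-1)^{b_2} → R(-t)^{b_1} → R → R/I → 0`. -/
def HasLinearResolution {K : Type*} [Field K] {r : ℕ} (I : Ideal (MvPolynomial (Fin r) K))
    (t : ℕ) : Prop :=
  ∃ F : GradedFreeResolution I, F.IsMinimal ∧ F.rank 0 = 1 ∧ (∀ a, F.deg 0 a = 0) ∧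
    ∀ (i : ℕ) (a : Fin (F.rank (i + 1))), F.deg (i + 1) a = (i : ℤ) + t

/-- The products `x_i x_j` with `i, j ≤ n` and `x_i x_k` with `i ≤ n < k ≤ r`. The variable
`x_{i+1}` of the text is `X i` here, since `Fin r` starts at `0`. -/
def quadricGenerators (K : Type*) [Field K] (n r : ℕ) : Set (MvPolynomial (Fin r) K) :=
  {p | ∃ i j : Fin r, i.val < n ∧ j.val < n ∧ p = MvPolynomial.X i * MvPolynomial.X j} ∪
  {p | ∃ i k : Fin r, i.val < n ∧ n ≤ k.val ∧ p = MvPolynomial.X i * MvPolynomial.X k}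

/-- The ideal `J` generated by these products. -/
def quadricIdeal (K : Type*) [Field K] (n r : ℕ) : Ideal (MvPolynomial (Fin r) K) :=
  Ideal.span (quadricGenerators K n r)

end

/-! The ideal has linear quotients. Number the variables from 0 and list the generators `x_a x_b`
(`a ≤ b`, `a < n`) by the larger index `b`, then by `a`. The ideal of the generators listed before
`x_k x_m` has colon ideal `(x_0, …, x_{m-1})` with respect to `x_k x_m` (`quadricExponents_colon`).
The quotient by that colon ideal is resolved by a Koszul-type complex, itself an iterated mapping
cone (`hasLinearBetti_variableIdeal`).

Each new generator therefore replaces the current resolution by a mapping cone that adds `C(m, i)`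
basis elements of degree `i + 2` in homological degree `i + 1` (`HasLinearBetti.cone`). The larger
index `m` occurs for `min (m + 1) n` generators, so the rank of `F_{i+1}` is `∑_{m < r} min (m + 1)
n * C(m, i)`; hockey-stick summation gives the closed form (`sum_min_mul_choose`).

Linearity makes the resolution minimal, so its ranks compute Tor. Any other graded free resolution
gives the same dimensions, since a comparison map and a homotopy survive reduction modulo the
maximal ideal (`finrank_tor_eq`). -/

noncomputable section

open MvPolynomial

/-! ### Homogeneous components and graded maps between free modules -/

section GradedMaps

variable {K : Type*} [Field K] {r : ℕ}

attribute [local instance] MvPolynomial.gradedAlgebra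

theorem gradedPart_natCast (n : ℕ) :
    gradedPart K r (n : ℤ) = homogeneousSubmodule (Fin r) K n := by
  simp [gradedPart]

theorem gradedPart_of_neg {j : ℤ} (hj : j < 0) : gradedPart K r j = ⊥ := by
  simp [gradedPart, not_le.mpr hj]

theorem one_mem_gradedPart : (1 : MvPolynomial (Fin r) K) ∈ gradedPart K r 0 := by
  have := gradedPart_natCast (K := K) (r := r) 0
  rw [Nat.cast_zero] at this
  rw [this]
  exact isHomogeneous_one _ _

theorem constantCoeff_eq_zero_of_mem_gradedPart {j : ℤ} (hj : j ≠ 0)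
    {p : MvPolynomial (Fin r) K} (hp : p ∈ gradedPart K r j) : constantCoeff p = 0 := by
  rcases lt_or_ge j 0 with h | h
  · rw [gradedPart_of_neg h] at hp
    simp [(Submodule.mem_bot K).mp hp]
  · lift j to ℕ using h
    rw [gradedPart_natCast] at hp
    rw [constantCoeff_eq]
    refine IsHomogeneous.coeff_eq_zero hp ?_
    simpa using (Nat.cast_ne_zero.mp hj).symm

/-- The homogeneous component of degree `j : ℤ` of a polynomial. -/
def intComponent (j : ℤ) (p : MvPolynomial (Fin r) K) : MvPolynomial (Fin r) K :=
  if 0 ≤ j then homogeneousComponent j.toNat p else 0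

theorem intComponent_natCast (n : ℕ) (p : MvPolynomial (Fin r) K) :
    intComponent (n : ℤ) p = homogeneousComponent n p := by
  simp [intComponent]

theorem intComponent_of_neg {j : ℤ} (hj : j < 0) (p : MvPolynomial (Fin r) K) :
    intComponent j p = 0 := by
  simp [intComponent, not_le.mpr hj]

theorem intComponent_mem (j : ℤ) (p : MvPolynomial (Fin r) K) :
    intComponent j p ∈ gradedPart K r j := by
  rcases lt_or_ge j 0 with h | h
  · rw [intComponent_of_neg h]
    exact Submodule.zero_mem _
  · lift j to ℕ using h
    rw [intComponent_natCast, gradedPart_natCast]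
    exact homogeneousComponent_mem _ _

theorem intComponent_of_mem {j : ℤ} {p : MvPolynomial (Fin r) K} (hp : p ∈ gradedPart K r j) :
    intComponent j p = p := by
  rcases lt_or_ge j 0 with h | h
  · rw [gradedPart_of_neg h] at hp
    rw [intComponent_of_neg h, (Submodule.mem_bot K).mp hp]
  · lift j to ℕ using h
    rw [gradedPart_natCast] at hp
    rw [intComponent_natCast, homogeneousComponent_of_mem hp, if_pos rfl]

theorem intComponent_sub (j : ℤ) (p q : MvPolynomial (Fin r) K) :
    intComponent j (p - q) = intComponent j p - intComponent j q := by
  unfold intComponent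
  split_ifs <;> simp

theorem intComponent_sum {ι : Type*} (s : Finset ι) (j : ℤ) (p : ι → MvPolynomial (Fin r) K) :
    intComponent j (∑ a ∈ s, p a) = ∑ a ∈ s, intComponent j (p a) := by
  unfold intComponent
  split_ifs <;> simp

theorem intComponent_mem_ideal {I : Ideal (MvPolynomial (Fin r) K)}
    (hI : I.IsHomogeneous (homogeneousSubmodule (Fin r) K)) (j : ℤ) {p : MvPolynomial (Fin r) K}
    (hp : p ∈ I) : intComponent j p ∈ I := by
  unfold intComponent
  split_ifs
  · exact homogeneousComponent_mem_of_mem hI hp _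
  · exact I.zero_mem

theorem homogeneousComponent_mul_of_mem {n m : ℕ} (p : MvPolynomial (Fin r) K)
    {q : MvPolynomial (Fin r) K} (hq : q ∈ homogeneousSubmodule (Fin r) K m) :
    homogeneousComponent n (p * q) = if m ≤ n then homogeneousComponent (n - m) p * q else 0 := by
  have h := DirectSum.coe_decompose_mul_of_right_mem (homogeneousSubmodule (Fin r) K)
    (a := p) n hq
  rwa [show (DirectSum.decompose (homogeneousSubmodule (Fin r) K) (p * q) n :
      MvPolynomial (Fin r) K) = homogeneousComponent n (p * q) from
        decomposition.decompose'_apply _ _,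
    show (DirectSum.decompose (homogeneousSubmodule (Fin r) K) p (n - m) :
      MvPolynomial (Fin r) K) = homogeneousComponent (n - m) p from
        decomposition.decompose'_apply _ _] at h

/-- Integer degrees remove the case distinction: for `j < u` both sides vanish, because components
of negative degree are 0. -/
theorem intComponent_mul {j u : ℤ} (p : MvPolynomial (Fin r) K) {q : MvPolynomial (Fin r) K}
    (hq : q ∈ gradedPart K r u) : intComponent j (p * q) = intComponent (j - u) p * q := by
  rcases lt_or_ge u 0 with h | h
  · rw [gradedPart_of_neg h] at hq
    simp [(Submodule.mem_bot K).mp hq, intComponent]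
  · lift u to ℕ using h
    rw [gradedPart_natCast] at hq
    rcases lt_or_ge j 0 with h' | h'
    · rw [intComponent_of_neg h', intComponent_of_neg (by omega), zero_mul]
    · lift j to ℕ using h'
      rw [intComponent_natCast, homogeneousComponent_mul_of_mem p hq]
      split_ifs with hle
      · rw [← Nat.cast_sub hle, intComponent_natCast]
      · rw [intComponent_of_neg (by omega), zero_mul]

theorem mul_mem_gradedPart {i j : ℤ} {p q : MvPolynomial (Fin r) K} (hp : p ∈ gradedPart K r i)
    (hq : q ∈ gradedPart K r j) : p * q ∈ gradedPart K r (i + j) := by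
  have h := intComponent_mul (j := i + j) p hq
  rw [add_sub_cancel_right, intComponent_of_mem hp] at h
  rw [← h]
  exact intComponent_mem _ _

variable {ι κ l : Type*} [DecidableEq ι] [Fintype κ] [DecidableEq κ]

theorem linearMap_apply_eq_sum [Fintype ι] {A : Type*} [CommRing A]
    (L : (ι → A) →ₗ[A] (l → A)) (w : ι → A) (b : l) : L w b = ∑ a, w a * L (Pi.single a 1) b := by
  conv_lhs => rw [pi_eq_sum_univ' w]
  simp only [map_sum, map_smul, Finset.sum_apply, Pi.smul_apply, smul_eq_mul]

/-- A map `⨁_a R(-α a) → ⨁_b R(-β b)` that is homogeneous of degree `0`. -/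
def IsGradedMap (α : ι → ℤ) (β : l → ℤ)
    (L : (ι → MvPolynomial (Fin r) K) →ₗ[MvPolynomial (Fin r) K] (l → MvPolynomial (Fin r) K)) :
    Prop :=
  ∀ a b, L (Pi.single a 1) b ∈ gradedPart K r (α a - β b)

/-- The component of degree `j` of an element of `⨁_a R(-α a)`. -/
def piComponent (α : l → ℤ) (j : ℤ) (w : l → MvPolynomial (Fin r) K) :
    l → MvPolynomial (Fin r) K :=
  fun a => intComponent (j - α a) (w a)

theorem IsGradedMap.map_piComponent [Fintype ι] {α : ι → ℤ} {β : l → ℤ}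
    {L : (ι → MvPolynomial (Fin r) K) →ₗ[MvPolynomial (Fin r) K] (l → MvPolynomial (Fin r) K)}
    (hL : IsGradedMap α β L) (j : ℤ) (w : ι → MvPolynomial (Fin r) K) :
    L (piComponent α j w) = piComponent β j (L w) := by
  ext1 b
  simp only [piComponent]
  rw [linearMap_apply_eq_sum L w, linearMap_apply_eq_sum L, intComponent_sum]
  refine Finset.sum_congr rfl fun a _ => ?_
  rw [intComponent_mul _ (hL a b), sub_sub_sub_cancel_right]
  rfl

theorem IsGradedMap.apply_mem [Fintype ι] {α : ι → ℤ} {β : l → ℤ}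
    {L : (ι → MvPolynomial (Fin r) K) →ₗ[MvPolynomial (Fin r) K] (l → MvPolynomial (Fin r) K)}
    (hL : IsGradedMap α β L) {j : ℤ} {w : ι → MvPolynomial (Fin r) K}
    (hw : ∀ a, w a ∈ gradedPart K r (j - α a)) (b : l) : L w b ∈ gradedPart K r (j - β b) := by
  have h : piComponent α j w = w := funext fun a => intComponent_of_mem (hw a)
  rw [← h, hL.map_piComponent]
  exact intComponent_mem _ _

theorem IsGradedMap.comp {α : ι → ℤ} {β : κ → ℤ} {γ : l → ℤ}
    {L : (κ → MvPolynomial (Fin r) K) →ₗ[MvPolynomial (Fin r) K] (l → MvPolynomial (Fin r) K)}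
    {M : (ι → MvPolynomial (Fin r) K) →ₗ[MvPolynomial (Fin r) K] (κ → MvPolynomial (Fin r) K)}
    (hL : IsGradedMap β γ L) (hM : IsGradedMap α β M) : IsGradedMap α γ (L ∘ₗ M) :=
  fun a => hL.apply_mem (hM a)

theorem IsGradedMap.sub {α : ι → ℤ} {β : l → ℤ}
    {L M : (ι → MvPolynomial (Fin r) K) →ₗ[MvPolynomial (Fin r) K] (l → MvPolynomial (Fin r) K)}
    (hL : IsGradedMap α β L) (hM : IsGradedMap α β M) : IsGradedMap α β (L - M) :=
  fun a b => Submodule.sub_mem _ (hL a b) (hM a b)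

theorem IsGradedMap.id (α : ι → ℤ) :
    IsGradedMap α α (LinearMap.id (R := MvPolynomial (Fin r) K)
      (M := ι → MvPolynomial (Fin r) K)) := by
  intro a b
  by_cases h : b = a
  · subst h
    simpa using one_mem_gradedPart
  · simp [Pi.single_eq_of_ne h]

theorem IsGradedMap.smul {α : ι → ℤ} {β : l → ℤ} {t : ℤ} {f : MvPolynomial (Fin r) K}
    (hf : f ∈ gradedPart K r t)
    {L : (ι → MvPolynomial (Fin r) K) →ₗ[MvPolynomial (Fin r) K] (l → MvPolynomial (Fin r) K)}
    (hL : IsGradedMap α β L) : IsGradedMap (fun a => α a + t) β (f • L) := by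
  intro a b
  have h := mul_mem_gradedPart hf (hL a b)
  rwa [show t + (α a - β b) = α a + t - β b by ring] at h

theorem IsGradedMap.shift {α : ι → ℤ} {β : l → ℤ}
    {L : (ι → MvPolynomial (Fin r) K) →ₗ[MvPolynomial (Fin r) K] (l → MvPolynomial (Fin r) K)}
    (hL : IsGradedMap α β L) (t : ℤ) :
    IsGradedMap (fun a => α a + t) (fun b => β b + t) L := by
  intro a b
  have h := hL a b
  rwa [show α a - β b = α a + t - (β b + t) by ring] at h

/-- Any preimage of a basis vector's image may be replaced by its component of the right degree,
since `D` commutes with components and `I` is homogeneous. Working modulo `I` is needed to lift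
along an augmentation that takes values in `R` instead of `R/I`. -/
theorem IsGradedMap.exists_lift_mod [Fintype ι] {I : Ideal (MvPolynomial (Fin r) K)}
    (hI : I.IsHomogeneous (homogeneousSubmodule (Fin r) K))
    {α : ι → ℤ} {β : l → ℤ} {γ : κ → ℤ}
    {D : (κ → MvPolynomial (Fin r) K) →ₗ[MvPolynomial (Fin r) K] (l → MvPolynomial (Fin r) K)}
    {L : (ι → MvPolynomial (Fin r) K) →ₗ[MvPolynomial (Fin r) K] (l → MvPolynomial (Fin r) K)}
    (hD : IsGradedMap γ β D) (hL : IsGradedMap α β L)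
    (h : ∀ v, ∃ w, ∀ b, (D w - L v) b ∈ I) :
    ∃ φ : (ι → MvPolynomial (Fin r) K) →ₗ[MvPolynomial (Fin r) K] (κ → MvPolynomial (Fin r) K),
      IsGradedMap α γ φ ∧ ∀ v b, (D (φ v) - L v) b ∈ I := by
  choose w hw using fun a => h (Pi.single a 1)
  let φ := (Pi.basisFun (MvPolynomial (Fin r) K) ι).constr (MvPolynomial (Fin r) K)
    fun a => piComponent γ (α a) (w a)
  have hφ : ∀ a, φ (Pi.single a 1) = piComponent γ (α a) (w a) := fun a => by
    have := (Pi.basisFun (MvPolynomial (Fin r) K) ι).constr_basis (MvPolynomial (Fin r) K)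
      (fun a => piComponent γ (α a) (w a)) a
    rwa [Pi.basisFun_apply] at this
  refine ⟨φ, fun a b => ?_, fun v b => ?_⟩
  · rw [hφ]
    exact intComponent_mem _ _
  · have key : ∀ a, (D ∘ₗ φ - L) (Pi.single a 1) b ∈ I := fun a => by
      have h1 := intComponent_mem_ideal hI (α a - β b) (hw a b)
      rw [Pi.sub_apply, intComponent_sub, intComponent_of_mem (hL a b)] at h1
      have h2 := congrFun (hD.map_piComponent (α a) (w a)) b
      simp only [LinearMap.sub_apply, LinearMap.comp_apply, Pi.sub_apply, hφ, h2]
      exact h1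
    have h3 := linearMap_apply_eq_sum (D ∘ₗ φ - L) v b
    rw [show (D (φ v) - L v) b = (D ∘ₗ φ - L) v b from rfl, h3]
    exact Ideal.sum_mem _ fun a _ => I.mul_mem_left _ (key a)

theorem IsGradedMap.exists_lift [Fintype ι] {α : ι → ℤ} {β : l → ℤ} {γ : κ → ℤ}
    {D : (κ → MvPolynomial (Fin r) K) →ₗ[MvPolynomial (Fin r) K] (l → MvPolynomial (Fin r) K)}
    {L : (ι → MvPolynomial (Fin r) K) →ₗ[MvPolynomial (Fin r) K] (l → MvPolynomial (Fin r) K)}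
    (hD : IsGradedMap γ β D) (hL : IsGradedMap α β L) (h : ∀ v, ∃ w, D w = L v) :
    ∃ φ : (ι → MvPolynomial (Fin r) K) →ₗ[MvPolynomial (Fin r) K] (κ → MvPolynomial (Fin r) K),
      IsGradedMap α γ φ ∧ ∀ v, D (φ v) = L v := by
  obtain ⟨φ, h1, h2⟩ := exists_lift_mod
    (I := ⊥) (Ideal.IsHomogeneous.bot (homogeneousSubmodule (Fin r) K)) hD hL
    fun v => (h v).imp fun w hw b => by simp [hw]
  exact ⟨φ, h1, fun v => sub_eq_zero.mp (funext fun b => h2 v b)⟩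

end GradedMaps

/-- Dependent choice, for building chain maps and homotopies degree by degree: `P` is the invariant
that permits the next step, `Q` the relation between neighbours. -/
theorem exists_nat_seq {X : ℕ → Type*} (P : ∀ i, X i → Prop) (Q : ∀ i, X i → X (i + 1) → Prop)
    (x₀ : X 0) (h₀ : P 0 x₀) (h : ∀ i x, P i x → ∃ y, P (i + 1) y ∧ Q i x y) :
    ∃ x : ∀ i, X i, x 0 = x₀ ∧ ∀ i, P i (x i) ∧ Q i (x i) (x (i + 1)) := by
  choose g hg using h
  let s : ∀ i, {x : X i // P i x} := fun i =>
    Nat.rec ⟨x₀, h₀⟩ (fun i x => ⟨g i x.1 x.2, (hg i x.1 x.2).1⟩) i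
  exact ⟨fun i => (s i).1, rfl, fun i => ⟨(s i).2, (hg i (s i).1 (s i).2).2⟩⟩

/-- A graded free resolution of `R/I` whose free modules are indexed by arbitrary finite types;
the augmentation is given as a homogeneous map `F_0 → R` that has to be composed with
`R → R/I`. -/
structure IndexedResolution {K : Type*} [Field K] {r : ℕ}
    (I : Ideal (MvPolynomial (Fin r) K)) where
  /-- the index type of the basis of `F_i` -/
  ι : ℕ → Type
  [fintype : ∀ i, Fintype (ι i)]
  [decEq : ∀ i, DecidableEq (ι i)]
  /-- the degrees of the basis elements of `F_i` -/
  deg : ∀ i, ι i → ℤ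
  /-- the differential `F_{i+1} → F_i` -/
  d : ∀ i, (ι (i + 1) → MvPolynomial (Fin r) K) →ₗ[MvPolynomial (Fin r) K]
    (ι i → MvPolynomial (Fin r) K)
  /-- the augmentation `F_0 → R` -/
  aug : (ι 0 → MvPolynomial (Fin r) K) →ₗ[MvPolynomial (Fin r) K]
    (Unit → MvPolynomial (Fin r) K)
  d_graded : ∀ i, IsGradedMap (deg (i + 1)) (deg i) (d i)
  aug_graded : IsGradedMap (deg 0) (fun _ => 0) aug
  aug_surjective : ∀ p, ∃ w, aug w () - p ∈ I
  exact_zero : ∀ w, aug w () ∈ I ↔ ∃ v, d 0 v = w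
  exact_succ : ∀ i w, d i w = 0 ↔ ∃ v, d (i + 1) v = w

/-! ### Comparison maps and homotopies -/

namespace IndexedResolution

attribute [instance] fintype decEq

attribute [local instance] MvPolynomial.gradedAlgebra

variable {K : Type*} [Field K] {r : ℕ} {I Q : Ideal (MvPolynomial (Fin r) K)}

theorem d_d (F : IndexedResolution I) (i : ℕ) (v : F.ι (i + 1 + 1) → MvPolynomial (Fin r) K) :
    F.d i (F.d (i + 1) v) = 0 :=
  (F.exact_succ i _).mpr ⟨v, rfl⟩

theorem aug_d (F : IndexedResolution I) (v : F.ι 1 → MvPolynomial (Fin r) K) :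
    F.aug (F.d 0 v) () ∈ I :=
  (F.exact_zero _).mpr ⟨v, rfl⟩

/-- A chain map that lifts multiplication by a form `f` with `f Q ⊆ I` from `R/Q` to `R/I`. -/
theorem exists_chainMap (hI : I.IsHomogeneous (homogeneousSubmodule (Fin r) K))
    (F : IndexedResolution I) (G : IndexedResolution Q) {t : ℤ} {f : MvPolynomial (Fin r) K}
    (hf : f ∈ gradedPart K r t) (hfQ : ∀ p ∈ Q, f * p ∈ I) :
    ∃ φ : ∀ i, (G.ι i → MvPolynomial (Fin r) K) →ₗ[MvPolynomial (Fin r) K]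
        (F.ι i → MvPolynomial (Fin r) K),
      (∀ i, IsGradedMap (fun a => G.deg i a + t) (F.deg i) (φ i)) ∧
      (∀ v, F.aug (φ 0 v) () - f * G.aug v () ∈ I) ∧
      ∀ i v, F.d i (φ (i + 1) v) = φ i (G.d i v) := by
  obtain ⟨φ₀, h1, h2⟩ := F.aug_graded.exists_lift_mod hI (G.aug_graded.smul hf) fun v =>
    (F.aug_surjective (f * G.aug v ())).imp fun w hw _ => hw
  have h2' : ∀ v, F.aug (φ₀ v) () - f * G.aug v () ∈ I := fun v => h2 v ()
  obtain ⟨φ, h3, h4⟩ := exists_nat_seq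
    (X := fun i => (G.ι i → MvPolynomial (Fin r) K) →ₗ[MvPolynomial (Fin r) K]
        (F.ι i → MvPolynomial (Fin r) K))
    -- The invariant says that `φ ∘ d` takes values in the image of `F.d i`, which is what the next
    -- lift requires.
    (fun i φ => IsGradedMap (fun a => G.deg i a + t) (F.deg i) φ ∧
      ∀ v, ∃ w, F.d i w = φ (G.d i v))
    (fun i φ φ' => ∀ v, F.d i (φ' v) = φ (G.d i v)) φ₀
    ⟨h1, fun v => by
      rw [← F.exact_zero]
      have h5 := I.add_mem (h2' (G.d 0 v)) (hfQ _ (G.aug_d v))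
      rwa [sub_add_cancel] at h5⟩
    fun i φ hφ => by
      obtain ⟨φ', h6, h7⟩ := (F.d_graded i).exists_lift
        (hφ.1.comp ((G.d_graded i).shift t)) hφ.2
      refine ⟨φ', ⟨h6, fun v => ?_⟩, h7⟩
      rw [← F.exact_succ, h7, LinearMap.comp_apply, G.d_d, map_zero]
  exact ⟨φ, fun i => (h4 i).1.1, by rwa [h3], fun i => (h4 i).2⟩

theorem exists_comparison (hI : I.IsHomogeneous (homogeneousSubmodule (Fin r) K))
    (F G : IndexedResolution I) :
    ∃ φ : ∀ i, (G.ι i → MvPolynomial (Fin r) K) →ₗ[MvPolynomial (Fin r) K]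
        (F.ι i → MvPolynomial (Fin r) K),
      (∀ i, IsGradedMap (G.deg i) (F.deg i) (φ i)) ∧
      (∀ v, F.aug (φ 0 v) () - G.aug v () ∈ I) ∧
      ∀ i v, F.d i (φ (i + 1) v) = φ i (G.d i v) := by
  simpa using exists_chainMap hI F G (one_mem_gradedPart (K := K) (r := r)) (by simp)

/-- A chain map that induces `0` on `R/I` is null-homotopic. -/
theorem exists_homotopy (F G : IndexedResolution I)
    (g : ∀ i, (G.ι i → MvPolynomial (Fin r) K) →ₗ[MvPolynomial (Fin r) K]
        (F.ι i → MvPolynomial (Fin r) K))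
    (hg : ∀ i, IsGradedMap (G.deg i) (F.deg i) (g i)) (hg0 : ∀ v, F.aug (g 0 v) () ∈ I)
    (hgd : ∀ i v, F.d i (g (i + 1) v) = g i (G.d i v)) :
    ∃ h : ∀ i, (G.ι i → MvPolynomial (Fin r) K) →ₗ[MvPolynomial (Fin r) K]
        (F.ι (i + 1) → MvPolynomial (Fin r) K),
      (∀ i, IsGradedMap (G.deg i) (F.deg (i + 1)) (h i)) ∧
      (∀ v, F.d 0 (h 0 v) = g 0 v) ∧
      ∀ i v, F.d (i + 1) (h (i + 1) v) = g (i + 1) v - h i (G.d i v) := by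
  obtain ⟨h₀, h1, h2⟩ := (F.d_graded 0).exists_lift (hg 0) fun v =>
    (F.exact_zero _).mp (hg0 v)
  obtain ⟨h, h3, h4⟩ := exists_nat_seq
    (X := fun i => (G.ι i → MvPolynomial (Fin r) K) →ₗ[MvPolynomial (Fin r) K]
        (F.ι (i + 1) → MvPolynomial (Fin r) K))
    -- The invariant `d h d = g d` makes `g - h d` in the next degree a map into cycles, so it lifts
    -- through the differential.
    (fun i h => IsGradedMap (G.deg i) (F.deg (i + 1)) h ∧
      ∀ v, F.d i (h (G.d i v)) = g i (G.d i v))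
    (fun i h h' => ∀ v, F.d (i + 1) (h' v) = g (i + 1) v - h (G.d i v)) h₀
    ⟨h1, fun v => h2 _⟩
    fun i h hh => by
      obtain ⟨h', h6, h7⟩ := (F.d_graded (i + 1)).exists_lift
        ((hg (i + 1)).sub (hh.1.comp (G.d_graded i))) fun v => by
          rw [← F.exact_succ]
          simp [hgd, hh.2]
      exact ⟨h', ⟨h6, fun v => by rw [h7]; simp [G.d_d]⟩, h7⟩
  exact ⟨h, fun i => (h4 i).1.1, by rwa [h3], fun i => (h4 i).2⟩

/-- `F_i` with the basis indexed by `Fin`. -/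
def reindex (F : IndexedResolution I) (i : ℕ) :
    (Fin (Fintype.card (F.ι i)) → MvPolynomial (Fin r) K) ≃ₗ[MvPolynomial (Fin r) K]
      (F.ι i → MvPolynomial (Fin r) K) :=
  LinearEquiv.funCongrLeft _ _ (Fintype.equivFin (F.ι i))

theorem reindex_single (F : IndexedResolution I) (i : ℕ) (a : Fin (Fintype.card (F.ι i))) :
    F.reindex i (Pi.single a 1) = Pi.single ((Fintype.equivFin (F.ι i)).symm a) 1 := by
  ext1 c
  simp [reindex, LinearEquiv.funCongrLeft_apply, LinearMap.funLeft_apply, Pi.single_apply,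
    Equiv.eq_symm_apply]

/-- Replace the index types by `Fin`. -/
def toGraded (F : IndexedResolution I) : GradedFreeResolution I where
  rank i := Fintype.card (F.ι i)
  deg i a := F.deg i ((Fintype.equivFin (F.ι i)).symm a)
  d i := (F.reindex i).symm.toLinearMap ∘ₗ F.d i ∘ₗ (F.reindex (i + 1)).toLinearMap
  ε := (Ideal.Quotient.mkₐ _ I).toLinearMap ∘ₗ LinearMap.proj () ∘ₗ F.aug ∘ₗ
    (F.reindex 0).toLinearMap
  d_homogeneous i a b := by
    have h := F.d_graded i ((Fintype.equivFin (F.ι (i + 1))).symm a)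
      ((Fintype.equivFin (F.ι i)).symm b)
    rwa [← reindex_single] at h
  ε_homogeneous a := by
    have h := F.aug_graded ((Fintype.equivFin (F.ι 0)).symm a) ()
    rw [← reindex_single, sub_zero] at h
    exact ⟨_, h, rfl⟩
  ε_surjective q := by
    obtain ⟨p, rfl⟩ := Ideal.Quotient.mk_surjective q
    obtain ⟨w, hw⟩ := F.aug_surjective p
    obtain ⟨v, rfl⟩ := (F.reindex 0).surjective w
    exact ⟨v, (Ideal.Quotient.mk_eq_mk_iff_sub_mem _ _).mpr hw⟩
  exact_zero w := by
    refine Ideal.Quotient.eq_zero_iff_mem.trans ((F.exact_zero _).trans ?_)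
    rw [(F.reindex 1).surjective.exists]
    simp only [Set.mem_range, LinearMap.comp_apply, LinearEquiv.coe_coe,
      LinearEquiv.symm_apply_eq]
  exact_succ i w := by
    simp only [Set.mem_range, LinearMap.comp_apply, LinearEquiv.coe_coe,
      LinearEquiv.symm_apply_eq, map_zero]
    rw [F.exact_succ, (F.reindex (i + 2)).surjective.exists]

end IndexedResolution

namespace GradedFreeResolution

variable {K : Type*} [Field K] {r : ℕ} {I : Ideal (MvPolynomial (Fin r) K)}

attribute [local instance] MvPolynomial.gradedAlgebra

/-- Lift the augmentation to `R`. -/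
theorem exists_indexed (F : GradedFreeResolution I) :
    ∃ aug : (Fin (F.rank 0) → MvPolynomial (Fin r) K) →ₗ[MvPolynomial (Fin r) K]
      (Unit → MvPolynomial (Fin r) K),
      IsGradedMap (F.deg 0) (fun _ => 0) aug ∧
      ∀ w, Ideal.Quotient.mk I (aug w ()) = F.ε w := by
  choose p hp hε using F.ε_homogeneous
  let aug := (Pi.basisFun (MvPolynomial (Fin r) K) (Fin (F.rank 0))).constr
    (MvPolynomial (Fin r) K) fun a => fun _ : Unit => p a
  have haug : ∀ a, aug (Pi.single a 1) = fun _ => p a := fun a => by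
    have := (Pi.basisFun (MvPolynomial (Fin r) K) (Fin (F.rank 0))).constr_basis
      (MvPolynomial (Fin r) K) (fun a => fun _ : Unit => p a) a
    rwa [Pi.basisFun_apply] at this
  refine ⟨aug, fun a b => ?_, fun w => ?_⟩
  · rw [haug, sub_zero]
    exact hp a
  · have h : (Ideal.Quotient.mkₐ (MvPolynomial (Fin r) K) I).toLinearMap ∘ₗ
        LinearMap.proj () ∘ₗ aug = F.ε := by
      refine (Pi.basisFun (MvPolynomial (Fin r) K) (Fin (F.rank 0))).ext fun a => ?_
      simp only [Pi.basisFun_apply, LinearMap.comp_apply, haug, hε]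
      rfl
    exact LinearMap.congr_fun h w

/-- A graded free resolution as an indexed one. -/
def toIndexed (F : GradedFreeResolution I) : IndexedResolution I where
  ι i := Fin (F.rank i)
  deg := F.deg
  d := F.d
  aug := F.exists_indexed.choose
  d_graded := F.d_homogeneous
  aug_graded := F.exists_indexed.choose_spec.1
  aug_surjective p := by
    obtain ⟨w, hw⟩ := F.ε_surjective (Ideal.Quotient.mk I p)
    refine ⟨w, ?_⟩
    rw [← Ideal.Quotient.mk_eq_mk_iff_sub_mem, F.exists_indexed.choose_spec.2, hw]
  exact_zero w := by
    rw [← Ideal.Quotient.eq_zero_iff_mem, F.exists_indexed.choose_spec.2]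
    exact F.exact_zero w
  exact_succ i w := F.exact_succ i w

end GradedFreeResolution

/-! ### Reduction modulo the maximal ideal -/

section BarMap

variable {K : Type*} [Field K] {r : ℕ} {ι κ l : Type*} [Fintype ι] [DecidableEq ι]
  [Fintype κ] [DecidableEq κ]

/-- The map `L ⊗_R K`. -/
def barMap
    (L : (ι → MvPolynomial (Fin r) K) →ₗ[MvPolynomial (Fin r) K] (l → MvPolynomial (Fin r) K)) :
    (ι → K) →ₗ[K] (l → K) :=
  Matrix.mulVecLin (Matrix.of fun b a => constantCoeff (L (Pi.single a 1) b))

theorem barMap_apply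
    (L : (ι → MvPolynomial (Fin r) K) →ₗ[MvPolynomial (Fin r) K] (l → MvPolynomial (Fin r) K))
    (z : ι → K) (b : l) : barMap L z b = ∑ a, constantCoeff (L (Pi.single a 1) b) * z a := rfl

theorem constantCoeff_linearMap_apply
    (L : (ι → MvPolynomial (Fin r) K) →ₗ[MvPolynomial (Fin r) K] (l → MvPolynomial (Fin r) K))
    (w : ι → MvPolynomial (Fin r) K) :
    (fun b => constantCoeff (L w b)) = barMap L (fun a => constantCoeff (w a)) := by
  ext1 b
  rw [linearMap_apply_eq_sum, map_sum, barMap_apply]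
  exact Finset.sum_congr rfl fun a _ => by rw [map_mul, mul_comm]

theorem barMap_eq
    (L : (ι → MvPolynomial (Fin r) K) →ₗ[MvPolynomial (Fin r) K] (l → MvPolynomial (Fin r) K))
    (z : ι → K) : barMap L z = fun b => constantCoeff (L (fun a => C (z a)) b) := by
  rw [constantCoeff_linearMap_apply]
  simp

theorem barMap_comp
    (L : (κ → MvPolynomial (Fin r) K) →ₗ[MvPolynomial (Fin r) K] (l → MvPolynomial (Fin r) K))
    (M : (ι → MvPolynomial (Fin r) K) →ₗ[MvPolynomial (Fin r) K] (κ → MvPolynomial (Fin r) K))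
    (z : ι → K) : barMap (L ∘ₗ M) z = barMap L (barMap M z) := by
  rw [barMap_eq M, ← constantCoeff_linearMap_apply, barMap_eq]
  rfl

theorem barMap_sub
    (L M : (ι → MvPolynomial (Fin r) K) →ₗ[MvPolynomial (Fin r) K] (l → MvPolynomial (Fin r) K))
    (z : ι → K) : barMap (L - M) z = barMap L z - barMap M z := by
  ext1 b
  simp [barMap_eq]

theorem barMap_id (z : ι → K) :
    barMap (LinearMap.id (R := MvPolynomial (Fin r) K) (M := ι → MvPolynomial (Fin r) K)) z
      = z := by
  ext1 b
  simp [barMap_eq]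

/-- A matrix entry with nonzero constant term has degree 0, so it joins basis elements of equal
degree; reduction thus preserves degrees. -/
theorem IsGradedMap.barMap_apply_eq_zero {α : ι → ℤ} {β : l → ℤ}
    {L : (ι → MvPolynomial (Fin r) K) →ₗ[MvPolynomial (Fin r) K] (l → MvPolynomial (Fin r) K)}
    (hL : IsGradedMap α β L) {j : ℤ} {v : ι → K} (hv : ∀ a, α a ≠ j → v a = 0) (b : l)
    (hb : β b ≠ j) : barMap L v b = 0 := by
  rw [barMap_apply]
  refine Finset.sum_eq_zero fun a _ => ?_
  by_cases h : α a = j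
  · rw [constantCoeff_eq_zero_of_mem_gradedPart (fun h' => hb (by omega)) (hL a b), zero_mul]
  · rw [hv a h, mul_zero]

end BarMap

/-! ### Independence of Tor from the resolution -/

namespace GradedFreeResolution

variable {K : Type*} [Field K] {r : ℕ} {I : Ideal (MvPolynomial (Fin r) K)}

attribute [local instance] MvPolynomial.gradedAlgebra

theorem dBar_eq (F : GradedFreeResolution I) (i : ℕ) : F.dBar i = barMap (F.d i) := rfl

/-- Any two graded free resolutions are homotopy equivalent, so that the homology of
`F ⊗_R K` embeds into that of `G ⊗_R K`. -/
theorem finrank_tor_le (hI : I.IsHomogeneous (homogeneousSubmodule (Fin r) K))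
    (F G : GradedFreeResolution I) (i : ℕ) (j : ℤ) :
    Module.finrank K (F.Tor i j) ≤ Module.finrank K (G.Tor i j) := by
  obtain ⟨φ, hφ, hφ0, hφd⟩ := IndexedResolution.exists_comparison hI G.toIndexed F.toIndexed
  obtain ⟨ψ, hψ, hψ0, hψd⟩ := IndexedResolution.exists_comparison hI F.toIndexed G.toIndexed
  -- Only `ψ φ ≃ id` is needed: it makes `φ` injective on homology, and exchanging `F` and `G` gives
  -- the other inequality.
  obtain ⟨h, hh, hh0, hhd⟩ := IndexedResolution.exists_homotopy F.toIndexed F.toIndexed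
    (fun i => ψ i ∘ₗ φ i - LinearMap.id)
    (fun i => ((hψ i).comp (hφ i)).sub (IsGradedMap.id _))
    (fun v => by
      have := I.add_mem (hψ0 (φ 0 v)) (hφ0 v)
      simpa using this)
    (fun i v => by
      simp only [LinearMap.sub_apply, LinearMap.comp_apply, LinearMap.id_apply, map_sub]
      rw [hψd, hφd])
  change ∀ i, (Fin (F.rank i) → MvPolynomial (Fin r) K) →ₗ[MvPolynomial (Fin r) K]
    (Fin (G.rank i) → MvPolynomial (Fin r) K) at φ
  change ∀ i, (Fin (G.rank i) → MvPolynomial (Fin r) K) →ₗ[MvPolynomial (Fin r) K]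
    (Fin (F.rank i) → MvPolynomial (Fin r) K) at ψ
  change ∀ i, (Fin (F.rank i) → MvPolynomial (Fin r) K) →ₗ[MvPolynomial (Fin r) K]
    (Fin (F.rank (i + 1)) → MvPolynomial (Fin r) K) at h
  have bφ : ∀ i z, G.dBar i (barMap (φ (i + 1)) z) = barMap (φ i) (F.dBar i z) := fun i z => by
    rw [dBar_eq, dBar_eq, ← barMap_comp, ← barMap_comp]
    exact congrArg (fun L => barMap L z) (LinearMap.ext fun v => hφd i v)
  have bψ : ∀ i z, F.dBar i (barMap (ψ (i + 1)) z) = barMap (ψ i) (G.dBar i z) := fun i z => by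
    rw [dBar_eq, dBar_eq, ← barMap_comp, ← barMap_comp]
    exact congrArg (fun L => barMap L z) (LinearMap.ext fun v => hψd i v)
  have bh0 : ∀ z, F.dBar 0 (barMap (h 0) z) = barMap (ψ 0) (barMap (φ 0) z) - z := fun z => by
    have e : F.d 0 ∘ₗ h 0 = ψ 0 ∘ₗ φ 0 - LinearMap.id := LinearMap.ext hh0
    rw [dBar_eq, ← barMap_comp, ← barMap_comp, e, barMap_sub, barMap_id]
  have bh : ∀ i z, F.dBar (i + 1) (barMap (h (i + 1)) z) =
      barMap (ψ (i + 1)) (barMap (φ (i + 1)) z) - z - barMap (h i) (F.dBar i z) := fun i z => by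
    have e : F.d (i + 1) ∘ₗ h (i + 1) =
        (ψ (i + 1) ∘ₗ φ (i + 1) - LinearMap.id) - h i ∘ₗ F.d i := LinearMap.ext (hhd i)
    rw [dBar_eq, dBar_eq, ← barMap_comp, ← barMap_comp, ← barMap_comp, e, barMap_sub, barMap_sub,
      barMap_id]
  have ker_split : ∀ i, ∀ z ∈ F.kerBar i,
      F.dBar i (barMap (h i) z) = barMap (ψ i) (barMap (φ i) z) - z := by
    intro i z hz
    cases i with
    | zero => exact bh0 z
    | succ i => rw [bh, LinearMap.mem_ker.mp hz, map_zero, sub_zero]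
  have hcyc : ∀ z ∈ F.cycles i j, barMap (φ i) z ∈ G.cycles i j := by
    rintro z ⟨h1, h2⟩
    refine ⟨(hφ i).barMap_apply_eq_zero h1, ?_⟩
    cases i with
    | zero => trivial
    | succ i =>
      refine LinearMap.mem_ker.mpr ?_
      rw [bφ, LinearMap.mem_ker.mp h2, map_zero]
  have hbd : ∀ z ∈ F.boundaries i j, barMap (φ i) z ∈ G.boundaries i j := by
    rintro z ⟨u, hu, rfl⟩
    exact ⟨barMap (φ (i + 1)) u, (hφ (i + 1)).barMap_apply_eq_zero hu, bφ i u⟩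
  refine LinearMap.finrank_le_finrank_of_injective
    (f := Submodule.mapQ _ _ ((barMap (φ i)).restrict hcyc) fun z hz => hbd _ hz) ?_
  rw [← LinearMap.ker_eq_bot, LinearMap.ker_eq_bot']
  intro q hq
  obtain ⟨⟨z, hz⟩, rfl⟩ := Submodule.Quotient.mk_surjective _ q
  obtain ⟨u, hu, hu'⟩ := (Submodule.Quotient.mk_eq_zero _).mp hq
  rw [Submodule.Quotient.mk_eq_zero]
  change G.dBar i u = barMap (φ i) z at hu'
  -- If `φ z = d u` after reduction, then `d (ψ u) = ψ (φ z) = z + d (h z)`, so `z` is the boundary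
  -- of `ψ u - h z`.
  refine ⟨barMap (ψ (i + 1)) u - barMap (h i) z,
    Submodule.sub_mem _ ((hψ (i + 1)).barMap_apply_eq_zero hu)
      ((hh i).barMap_apply_eq_zero hz.1), ?_⟩
  change F.dBar i _ = z
  rw [map_sub, bψ, hu', ker_split i z hz.2, sub_sub_cancel]

theorem finrank_tor_eq (hI : I.IsHomogeneous (homogeneousSubmodule (Fin r) K))
    (F G : GradedFreeResolution I) (i : ℕ) (j : ℤ) :
    Module.finrank K (F.Tor i j) = Module.finrank K (G.Tor i j) :=
  (finrank_tor_le hI F G i j).antisymm (finrank_tor_le hI G F i j)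

/-- A minimal resolution has as many basis elements in degree `j` as the homology of
`F ⊗_R K` has dimensions. -/
theorem finrank_tor_of_isMinimal (F : GradedFreeResolution I) (hF : F.IsMinimal) (i : ℕ) (j : ℤ) :
    Module.finrank K (F.Tor i j) = Module.finrank K (F.degreePart i j) := by
  have hd : ∀ i, F.dBar i = 0 := fun i => by
    ext1 a
    ext b
    simp [dBar, hF i]
  have h1 : F.cycles i j = F.degreePart i j := by
    cases i <;> simp [cycles, kerBar, hd]
  have h2 : F.boundaries i j = ⊥ := by simp [boundaries, hd]
  change Module.finrank K
    (F.cycles i j ⧸ (F.boundaries i j).submoduleOf (F.cycles i j)) = _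
  rw [h2, ← h1]
  have h3 : (⊥ : Submodule K (Fin (F.rank i) → K)).submoduleOf (F.cycles i j) = ⊥ := by
    simp [Submodule.submoduleOf]
  rw [h3]
  exact (Submodule.quotEquivOfEqBot _ rfl).finrank_eq

theorem finrank_degreePart_of_eq (F : GradedFreeResolution I) {i : ℕ} {j : ℤ}
    (h : ∀ a, F.deg i a = j) : Module.finrank K (F.degreePart i j) = F.rank i := by
  have : F.degreePart i j = ⊤ := eq_top_iff.mpr fun v _ a ha => absurd (h a) ha
  rw [this, finrank_top, Module.finrank_fin_fun]

theorem finrank_degreePart_of_ne (F : GradedFreeResolution I) {i : ℕ} {j : ℤ}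
    (h : ∀ a, F.deg i a ≠ j) : Module.finrank K (F.degreePart i j) = 0 := by
  have : F.degreePart i j = ⊥ := eq_bot_iff.mpr fun v hv => funext fun a => hv a (h a)
  rw [this, finrank_bot]

end GradedFreeResolution

/-! ### Mapping cones -/

section Cone

/-- The linear map `(x, y) ↦ (A x + B y, - D y)`. -/
def coneMap {S ι κ l μ : Type*} [CommRing S] (A : (ι → S) →ₗ[S] (κ → S))
    (B : (l → S) →ₗ[S] (κ → S)) (D : (l → S) →ₗ[S] (μ → S)) : (ι ⊕ l → S) →ₗ[S] (κ ⊕ μ → S) where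
  toFun w := Sum.elim (A (w ∘ Sum.inl) + B (w ∘ Sum.inr)) (-D (w ∘ Sum.inr))
  map_add' v w := by
    rw [Pi.add_comp, Pi.add_comp, map_add, map_add, map_add]
    ext (b | b)
    · simp only [Sum.elim_inl, Pi.add_apply]
      ring
    · simp only [Sum.elim_inr, Pi.add_apply, Pi.neg_apply]
      ring
  map_smul' c w := by
    rw [Pi.smul_comp, Pi.smul_comp, map_smul, map_smul, map_smul]
    ext (b | b) <;> simp [mul_add]

/-- The linear map `(x, y) ↦ A x + B y`. -/
def coneMapZero {S ι κ l : Type*} [CommRing S] (A : (ι → S) →ₗ[S] (κ → S))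
    (B : (l → S) →ₗ[S] (κ → S)) : (ι ⊕ l → S) →ₗ[S] (κ → S) :=
  A ∘ₗ LinearMap.funLeft S S Sum.inl + B ∘ₗ LinearMap.funLeft S S Sum.inr

theorem coneMap_elim {S ι κ l μ : Type*} [CommRing S] (A : (ι → S) →ₗ[S] (κ → S))
    (B : (l → S) →ₗ[S] (κ → S)) (D : (l → S) →ₗ[S] (μ → S)) (x : ι → S) (y : l → S) :
    coneMap A B D (Sum.elim x y) = Sum.elim (A x + B y) (-D y) := rfl

theorem coneMapZero_elim {S ι κ l : Type*} [CommRing S] (A : (ι → S) →ₗ[S] (κ → S))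
    (B : (l → S) →ₗ[S] (κ → S)) (x : ι → S) (y : l → S) :
    coneMapZero A B (Sum.elim x y) = A x + B y := rfl

theorem exists_sum_elim {S ι l : Type*} (w : ι ⊕ l → S) : ∃ x y, w = Sum.elim x y :=
  ⟨_, _, (Sum.elim_comp_inl_inr w).symm⟩

variable {K : Type*} [Field K] {r : ℕ} {ι κ l μ : Type*} [DecidableEq ι] [DecidableEq l]

theorem IsGradedMap.coneMap {α : ι → ℤ} {β : κ → ℤ} {γ : l → ℤ} {δ : μ → ℤ}
    {A : (ι → MvPolynomial (Fin r) K) →ₗ[MvPolynomial (Fin r) K] (κ → MvPolynomial (Fin r) K)}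
    {B : (l → MvPolynomial (Fin r) K) →ₗ[MvPolynomial (Fin r) K] (κ → MvPolynomial (Fin r) K)}
    {D : (l → MvPolynomial (Fin r) K) →ₗ[MvPolynomial (Fin r) K] (μ → MvPolynomial (Fin r) K)}
    (hA : IsGradedMap α β A) (hB : IsGradedMap γ β B) (hD : IsGradedMap γ δ D) :
    IsGradedMap (Sum.elim α γ) (Sum.elim β δ) (coneMap A B D) := by
  rintro (a | a) (b | b)
  · rw [← Sum.elim_single_zero, coneMap_elim]
    simpa using hA a b
  · rw [← Sum.elim_single_zero, coneMap_elim]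
    simp
  · rw [← Sum.elim_zero_single, coneMap_elim]
    simpa using hB a b
  · rw [← Sum.elim_zero_single, coneMap_elim]
    simpa using hD a b

theorem IsGradedMap.coneMapZero {α : ι → ℤ} {β : κ → ℤ} {γ : l → ℤ}
    {A : (ι → MvPolynomial (Fin r) K) →ₗ[MvPolynomial (Fin r) K] (κ → MvPolynomial (Fin r) K)}
    {B : (l → MvPolynomial (Fin r) K) →ₗ[MvPolynomial (Fin r) K] (κ → MvPolynomial (Fin r) K)}
    (hA : IsGradedMap α β A) (hB : IsGradedMap γ β B) :
    IsGradedMap (Sum.elim α γ) β (coneMapZero A B) := by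
  rintro (a | a) b
  · rw [← Sum.elim_single_zero, coneMapZero_elim]
    simpa using hA a b
  · rw [← Sum.elim_zero_single, coneMapZero_elim]
    simpa using hB a b

end Cone

namespace IndexedResolution

variable {K : Type*} [Field K] {r : ℕ} {I Q : Ideal (MvPolynomial (Fin r) K)}

/-- The index types of the mapping cone. -/
def coneIndex (F : IndexedResolution I) (G : IndexedResolution Q) : ℕ → Type
  | 0 => F.ι 0
  | i + 1 => F.ι (i + 1) ⊕ G.ι i

instance (F : IndexedResolution I) (G : IndexedResolution Q) : ∀ i, Fintype (coneIndex F G i)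
  | 0 => inferInstanceAs (Fintype (F.ι 0))
  | i + 1 => inferInstanceAs (Fintype (F.ι (i + 1) ⊕ G.ι i))

instance (F : IndexedResolution I) (G : IndexedResolution Q) : ∀ i, DecidableEq (coneIndex F G i)
  | 0 => inferInstanceAs (DecidableEq (F.ι 0))
  | i + 1 => inferInstanceAs (DecidableEq (F.ι (i + 1) ⊕ G.ι i))

/-- The degrees of the basis elements of the mapping cone. -/
def coneDeg (F : IndexedResolution I) (G : IndexedResolution Q) (t : ℤ) :
    ∀ i, coneIndex F G i → ℤ
  | 0 => F.deg 0
  | i + 1 => Sum.elim (F.deg (i + 1)) (fun a => G.deg i a + t)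

/-- The differential of the mapping cone. -/
def coneD (F : IndexedResolution I) (G : IndexedResolution Q)
    (φ : ∀ i, (G.ι i → MvPolynomial (Fin r) K) →ₗ[MvPolynomial (Fin r) K]
        (F.ι i → MvPolynomial (Fin r) K)) :
    ∀ i, (coneIndex F G (i + 1) → MvPolynomial (Fin r) K) →ₗ[MvPolynomial (Fin r) K]
      (coneIndex F G i → MvPolynomial (Fin r) K)
  | 0 => coneMapZero (F.d 0) (φ 0)
  | i + 1 => coneMap (F.d (i + 1)) (φ (i + 1)) (G.d i)

/-- The mapping cone of multiplication by a form `f`, as a resolution of `R/(I + (f))`. -/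
def cone (F : IndexedResolution I) (G : IndexedResolution Q) {t : ℤ} {f : MvPolynomial (Fin r) K}
    (hQ : ∀ p, p ∈ Q ↔ f * p ∈ I)
    (φ : ∀ i, (G.ι i → MvPolynomial (Fin r) K) →ₗ[MvPolynomial (Fin r) K]
        (F.ι i → MvPolynomial (Fin r) K))
    (hφ : ∀ i, IsGradedMap (fun a => G.deg i a + t) (F.deg i) (φ i))
    (hφ0 : ∀ v, F.aug (φ 0 v) () - f * G.aug v () ∈ I)
    (hφd : ∀ i v, F.d i (φ (i + 1) v) = φ i (G.d i v)) :
    IndexedResolution (I ⊔ Ideal.span {f}) where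
  ι := coneIndex F G
  deg := coneDeg F G t
  d := coneD F G φ
  aug := F.aug
  d_graded i := by
    cases i with
    | zero => exact (F.d_graded 0).coneMapZero (hφ 0)
    | succ i => exact (F.d_graded (i + 1)).coneMap (hφ (i + 1)) ((G.d_graded i).shift t)
  aug_graded := F.aug_graded
  aug_surjective p := (F.aug_surjective p).imp fun w hw => Ideal.mem_sup_left hw
  exact_zero w := by
    constructor
    · intro hw
      change F.ι 0 → MvPolynomial (Fin r) K at w
      obtain ⟨p, hp, q, hq, hpq⟩ := Submodule.mem_sup.mp hw
      obtain ⟨c, rfl⟩ := Ideal.mem_span_singleton.mp hq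
      obtain ⟨y, hy⟩ := G.aug_surjective c
      -- With `aug w = p + f c` and `y` lifting `c` modulo `Q`, the correction `φ 0 y` removes `f c`
      -- up to an element of `I`.
      obtain ⟨x, hx⟩ := (F.exact_zero (w - φ 0 y)).mp (by
        have h := I.sub_mem (I.sub_mem hp (hφ0 y)) ((hQ _).mp hy)
        have hpq' : p + f * c = F.aug w () := hpq
        rw [map_sub, Pi.sub_apply]
        convert h using 1
        linear_combination -hpq')
      refine ⟨(Sum.elim x y : F.ι 1 ⊕ G.ι 0 → MvPolynomial (Fin r) K), ?_⟩
      change coneMapZero (F.d 0) (φ 0) _ = _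
      rw [coneMapZero_elim, hx, sub_add_cancel]
    · rintro ⟨v, rfl⟩
      change F.ι 1 ⊕ G.ι 0 → MvPolynomial (Fin r) K at v
      obtain ⟨x, y, rfl⟩ := exists_sum_elim v
      change F.aug (coneMapZero (F.d 0) (φ 0) _) () ∈ _
      rw [coneMapZero_elim, map_add, Pi.add_apply]
      refine Ideal.add_mem _ (Ideal.mem_sup_left (F.aug_d x)) ?_
      rw [← sub_add_cancel (F.aug (φ 0 y) ()) (f * G.aug y ())]
      exact Ideal.add_mem _ (Ideal.mem_sup_left (hφ0 y))
        (Ideal.mem_sup_right (Ideal.mul_mem_right _ _ (Ideal.mem_span_singleton_self f)))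
  exact_succ i w := by
    change F.ι (i + 1) ⊕ G.ι i → MvPolynomial (Fin r) K at w
    obtain ⟨x, y, rfl⟩ := exists_sum_elim w
    -- Once `y = d y'`, the element `x + φ y'` is a cycle, hence some `d x'`. The preimage is `(x',
    -- -y')`; its sign cancels the one in `coneMap`.
    have hback : ∀ y', G.d i y' = y → F.d i x + φ i y = 0 →
        ∃ v, coneD F G φ (i + 1) v = Sum.elim x y := by
      intro y' hy' h
      obtain ⟨x', hx'⟩ := (F.exact_succ i (x + φ (i + 1) y')).mp (by
        rw [map_add, hφd, hy', h])
      refine ⟨(Sum.elim x' (-y') : F.ι (i + 2) ⊕ G.ι (i + 1) → MvPolynomial (Fin r) K), ?_⟩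
      change coneMap (F.d (i + 1)) (φ (i + 1)) (G.d i) _ = _
      rw [coneMap_elim, hx', map_neg, map_neg, add_neg_cancel_right, neg_neg, hy']
    have hforw : (∃ v, coneD F G φ (i + 1) v = Sum.elim x y) →
        F.d i x + φ i y = 0 ∧ ∃ y', G.d i y' = y := by
      rintro ⟨v, hv⟩
      change F.ι (i + 2) ⊕ G.ι (i + 1) → MvPolynomial (Fin r) K at v
      obtain ⟨x', y', rfl⟩ := exists_sum_elim v
      change coneMap (F.d (i + 1)) (φ (i + 1)) (G.d i) _ = _ at hv
      rw [coneMap_elim, Sum.elim_eq_iff] at hv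
      obtain ⟨rfl, rfl⟩ := hv
      exact ⟨by rw [map_add, F.d_d, hφd, map_neg]; simp, -y', map_neg _ _⟩
    cases i with
    | zero =>
      change coneMapZero (F.d 0) (φ 0) _ = 0 ↔ _
      rw [coneMapZero_elim]
      refine ⟨fun h => ?_, fun h => (hforw h).1⟩
      -- The cycle condition gives `f * aug y ∈ I`. Only here is it used that `Q` contains the whole
      -- colon ideal `I : f`; this makes the cone exact.
      obtain ⟨y', hy'⟩ := (G.exact_zero y).mp (by
        have h1 := congrFun (congrArg F.aug h) ()
        rw [map_add, map_zero, Pi.add_apply, Pi.zero_apply] at h1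
        have h2 := I.sub_mem (I.neg_mem (hφ0 y)) (F.aug_d x)
        rw [hQ]
        convert h2 using 1
        linear_combination h1)
      exact hback y' hy' h
    | succ i =>
      change coneMap (F.d (i + 1)) (φ (i + 1)) (G.d i) _ = 0 ↔ _
      rw [coneMap_elim, ← Sum.elim_zero_zero, Sum.elim_eq_iff, neg_eq_zero, G.exact_succ]
      exact ⟨fun h => h.2.elim fun y' hy' => hback y' hy' h.1, hforw⟩

/-- The index types of the free resolution of `R` by itself. -/
def trivialIndex : ℕ → Type
  | 0 => Unit
  | _ + 1 => Empty

instance : ∀ i, Fintype (trivialIndex i)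
  | 0 => inferInstanceAs (Fintype Unit)
  | _ + 1 => inferInstanceAs (Fintype Empty)

instance : ∀ i, DecidableEq (trivialIndex i)
  | 0 => inferInstanceAs (DecidableEq Unit)
  | _ + 1 => inferInstanceAs (DecidableEq Empty)

instance (i : ℕ) : IsEmpty (trivialIndex (i + 1)) := inferInstanceAs (IsEmpty Empty)

/-- The free resolution of `R` by itself. -/
def trivial : IndexedResolution (⊥ : Ideal (MvPolynomial (Fin r) K)) where
  ι := trivialIndex
  deg _ _ := 0
  d _ := 0
  aug := (LinearMap.id : (Unit → MvPolynomial (Fin r) K) →ₗ[MvPolynomial (Fin r) K] _)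
  d_graded _ a := isEmptyElim a
  aug_graded := IsGradedMap.id (fun _ : Unit => 0)
  aug_surjective p := ⟨fun _ => p, (Submodule.mem_bot _).mpr (sub_self p)⟩
  exact_zero w := by
    change Unit → MvPolynomial (Fin r) K at w
    refine ⟨fun h => ⟨0, funext fun _ => ((Submodule.mem_bot _).mp h).symm⟩, ?_⟩
    rintro ⟨v, rfl⟩
    exact Ideal.zero_mem _
  exact_succ i w := ⟨fun _ => ⟨0, Subsingleton.elim _ _⟩, fun _ => rfl⟩

end IndexedResolution

/-- `R/I` has a graded free resolution
`⋯ → R(-t-1)^{b 1} → R(-t)^{b 0} → R → R/I → 0`. -/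
def HasLinearBetti {K : Type*} [Field K] {r : ℕ} (I : Ideal (MvPolynomial (Fin r) K)) (t : ℕ)
    (b : ℕ → ℕ) : Prop :=
  ∃ F : IndexedResolution I, Fintype.card (F.ι 0) = 1 ∧ (∀ a, F.deg 0 a = 0) ∧
    ∀ i, Fintype.card (F.ι (i + 1)) = b i ∧ ∀ a, F.deg (i + 1) a = (i : ℤ) + t

/-! ### Linear resolutions under mapping cones -/

section LinearBetti

variable {K : Type*} [Field K] {r : ℕ} {I Q : Ideal (MvPolynomial (Fin r) K)}

attribute [local instance] MvPolynomial.gradedAlgebra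

theorem hasLinearBetti_bot (t : ℕ) :
    HasLinearBetti (⊥ : Ideal (MvPolynomial (Fin r) K)) t fun _ => 0 :=
  ⟨IndexedResolution.trivial, Fintype.card_unit, fun _ => rfl, fun i =>
    ⟨Fintype.card_empty, fun a => isEmptyElim (α := IndexedResolution.trivialIndex (i + 1)) a⟩⟩

/-- The module `G_i` has `C(k, i)` basis elements, all of degree `i`. Shifted by `t = deg f` it
joins `F_{i+1}`, whose basis also has degree `i + t`, so linearity persists. -/
theorem HasLinearBetti.cone (hI : I.IsHomogeneous (homogeneousSubmodule (Fin r) K))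
    {t : ℕ} {b : ℕ → ℕ} {k : ℕ} {f : MvPolynomial (Fin r) K}
    (hf : f ∈ homogeneousSubmodule (Fin r) K t) (hQ : ∀ p, p ∈ Q ↔ f * p ∈ I)
    (h : HasLinearBetti I t b) (h' : HasLinearBetti Q 1 fun i => k.choose (i + 1)) :
    HasLinearBetti (I ⊔ Ideal.span {f}) t fun i => b i + k.choose i := by
  obtain ⟨F, hF1, hF2, hF3⟩ := h
  obtain ⟨G, hG1, hG2, hG3⟩ := h'
  rw [← gradedPart_natCast] at hf
  obtain ⟨φ, h1, h2, h3⟩ := F.exists_chainMap hI G hf fun p hp => (hQ p).mp hp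
  refine ⟨F.cone G hQ φ h1 h2 h3, hF1, hF2, fun i => ⟨?_, ?_⟩⟩
  · change Fintype.card (F.ι (i + 1) ⊕ G.ι i) = _
    rw [Fintype.card_sum, (hF3 i).1]
    cases i with
    | zero => simp [hG1]
    | succ i => rw [(hG3 i).1]
  · rintro (a | a)
    · exact (hF3 i).2 a
    · change G.deg i a + t = _
      cases i with
      | zero => simp [hG2]
      | succ i => rw [(hG3 i).2]; push_cast; ring

/-- Minimality is forced by degrees: the entries of `F_1 → F_0` have degree `t + 1` and all later
ones degree 1. Writing `t + 1` excludes generators of degree 0. -/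
theorem HasLinearBetti.exists_graded {t : ℕ} {b : ℕ → ℕ} (h : HasLinearBetti I (t + 1) b) :
    ∃ F : GradedFreeResolution I, F.IsMinimal ∧ F.rank 0 = 1 ∧ (∀ a, F.deg 0 a = 0) ∧
      ∀ i, F.rank (i + 1) = b i ∧ ∀ a, F.deg (i + 1) a = (i : ℤ) + (t + 1 : ℕ) := by
  obtain ⟨F, hF1, hF2, hF3⟩ := h
  refine ⟨F.toGraded, fun i a c => ?_, hF1, fun a => hF2 _, fun i => ⟨(hF3 i).1,
    fun a => (hF3 i).2 _⟩⟩
  refine constantCoeff_eq_zero_of_mem_gradedPart ?_ (F.toGraded.d_homogeneous i a c)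
  change F.deg (i + 1) _ - F.deg i _ ≠ 0
  rw [(hF3 i).2]
  cases i with
  | zero => rw [hF2]; omega
  | succ i => rw [(hF3 i).2]; omega

end LinearBetti

/-! ### Linear quotients of the monomial ideals -/

section MonomialIdeals

variable {K : Type*} [Field K] {r : ℕ}

attribute [local instance] MvPolynomial.gradedAlgebra

/-- The ideal generated by the monomials with exponents in `S`. -/
def monomialIdeal (K : Type*) [Field K] {r : ℕ} (S : Set (Fin r →₀ ℕ)) :
    Ideal (MvPolynomial (Fin r) K) :=
  Ideal.span ((fun s => monomial s (1 : K)) '' S)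

theorem monomialIdeal_isHomogeneous (S : Set (Fin r →₀ ℕ)) :
    (monomialIdeal K S).IsHomogeneous (homogeneousSubmodule (Fin r) K) := by
  refine Ideal.homogeneous_span _ _ ?_
  rintro _ ⟨s, -, rfl⟩
  exact ⟨_, isHomogeneous_monomial 1 rfl⟩

theorem monomialIdeal_insert (S : Set (Fin r →₀ ℕ)) (e : Fin r →₀ ℕ) :
    monomialIdeal K (insert e S) = monomialIdeal K S ⊔ Ideal.span {monomial e 1} := by
  rw [monomialIdeal, Set.image_insert_eq, Ideal.span_insert, sup_comm]
  rfl

/-- Multiplying by a monomial only translates the support, so colon ideals can be checked one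
exponent at a time. -/
theorem monomial_mul_mem_monomialIdeal {S : Set (Fin r →₀ ℕ)} {e : Fin r →₀ ℕ}
    {p : MvPolynomial (Fin r) K} :
    monomial e 1 * p ∈ monomialIdeal K S ↔ ∀ m ∈ p.support, ∃ s ∈ S, s ≤ e + m := by
  rw [monomialIdeal, mem_ideal_span_monomial_image]
  constructor
  · intro h m hm
    refine h _ ?_
    rw [mem_support_iff, coeff_monomial_mul, one_mul]
    exact mem_support_iff.mp hm
  · intro h m hm
    rw [mem_support_iff, coeff_monomial_mul'] at hm
    split_ifs at hm with hle
    · rw [one_mul] at hm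
      have := h _ (mem_support_iff.mpr hm)
      rwa [add_tsub_cancel_of_le hle] at this
    · exact absurd rfl hm

/-- The exponents of the variables with index less than `k`. -/
def variableExponents (r k : ℕ) : Set (Fin r →₀ ℕ) :=
  {e | ∃ b : Fin r, b.val < k ∧ e = Finsupp.single b 1}

theorem mem_variableIdeal {k : ℕ} {p : MvPolynomial (Fin r) K} :
    p ∈ monomialIdeal K (variableExponents r k) ↔
      ∀ m ∈ p.support, ∃ b : Fin r, b.val < k ∧ m b ≠ 0 := by
  rw [monomialIdeal, mem_ideal_span_monomial_image]
  refine forall₂_congr fun m _ => ?_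
  simp [variableExponents, Nat.one_le_iff_ne_zero]

/-- The variable `x_k` is a nonzerodivisor modulo `(x_0, …, x_{k-1})`, so this ideal is its own
colon ideal. The cone of two copies of its resolution has the ranks given by Pascal's rule. -/
theorem hasLinearBetti_variableIdeal (k : ℕ) (hk : k ≤ r) :
    HasLinearBetti (monomialIdeal K (variableExponents r k)) 1 fun i => k.choose (i + 1) := by
  induction k with
  | zero =>
    have h : monomialIdeal K (variableExponents r 0) = ⊥ := by
      simp [monomialIdeal, variableExponents]
    rw [h]
    simpa using hasLinearBetti_bot 1
  | succ k ih =>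
    have h : variableExponents r (k + 1) =
        insert (Finsupp.single ⟨k, hk⟩ 1) (variableExponents r k) := by
      ext e
      simp only [variableExponents, Set.mem_ofPred_eq, Set.mem_insert_iff]
      constructor
      · rintro ⟨b, hb, rfl⟩
        rcases Nat.lt_succ_iff_lt_or_eq.mp hb with hb | hb
        · exact Or.inr ⟨b, hb, rfl⟩
        · exact Or.inl (by subst hb; rfl)
      · rintro (rfl | ⟨b, hb, rfl⟩)
        · exact ⟨_, Nat.lt_succ_self k, rfl⟩
        · exact ⟨b, by omega, rfl⟩
    have ih := ih (by omega)
    rw [h, monomialIdeal_insert]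
    have := HasLinearBetti.cone (f := monomial (Finsupp.single ⟨k, hk⟩ 1) 1)
      (monomialIdeal_isHomogeneous _)
      (isHomogeneous_monomial 1 (Finsupp.degree_single _ _)) ?_ ih ih
    · convert this using 2 with i
      rw [Nat.choose_succ_succ, add_comm]
    · intro p
      rw [monomial_mul_mem_monomialIdeal, mem_variableIdeal]
      refine forall₂_congr fun m _ => ?_
      constructor
      · rintro ⟨b, hb, hm⟩
        refine ⟨_, ⟨b, hb, rfl⟩, ?_⟩
        rw [Finsupp.single_le_iff, Finsupp.add_apply]
        omega
      · rintro ⟨_, ⟨b, hb, rfl⟩, hm⟩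
        refine ⟨b, hb, ?_⟩
        rw [Finsupp.single_le_iff, Finsupp.add_apply, Finsupp.single_apply, if_neg] at hm
        · omega
        · rintro rfl
          exact lt_irrefl _ hb

/-- The exponents of the products `x_a x_b` with `a < n`, `a ≤ b` and either `b < m`, or `b = m` and
`a < k`. -/
def quadricExponents (r n m k : ℕ) : Set (Fin r →₀ ℕ) :=
  {e | ∃ a b : Fin r, a.val < n ∧ a ≤ b ∧ (b.val < m ∨ b.val = m ∧ a.val < k) ∧
    e = Finsupp.single a 1 + Finsupp.single b 1}

/-- The layer with larger index `m` is complete after `min (m + 1) n` steps, because the smaller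
index satisfies `a ≤ m` and `a < n`. -/
theorem quadricExponents_succ_zero {n m : ℕ} :
    quadricExponents r n (m + 1) 0 = quadricExponents r n m (min (m + 1) n) := by
  ext e
  refine exists₂_congr fun a b => ?_
  rw [Fin.le_def]
  constructor <;> rintro ⟨h1, h2, h3, h4⟩ <;> exact ⟨h1, h2, by omega, h4⟩

theorem quadricExponents_succ {n m k : ℕ} (hm : m < r) (hkm : k ≤ m) (hkn : k < n) :
    quadricExponents r n m (k + 1) =
      insert (Finsupp.single ⟨k, hkm.trans_lt hm⟩ 1 + Finsupp.single ⟨m, hm⟩ 1)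
        (quadricExponents r n m k) := by
  ext e
  simp only [quadricExponents, Set.mem_ofPred_eq, Set.mem_insert_iff]
  constructor
  · rintro ⟨a, b, h1, h2, h3, rfl⟩
    by_cases h : b.val = m ∧ a.val = k
    · obtain ⟨rfl, rfl⟩ := h
      exact Or.inl rfl
    · exact Or.inr ⟨a, b, h1, h2, by omega, rfl⟩
  · rintro (rfl | ⟨a, b, h1, h2, h3, rfl⟩)
    · exact ⟨_, _, hkn, Fin.le_def.mpr hkm, Or.inr ⟨rfl, Nat.lt_succ_self k⟩, rfl⟩
    · exact ⟨a, b, h1, h2, by omega, rfl⟩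

/-- The colon ideals of the quadrics are generated by variables. -/
theorem quadricExponents_colon {n m k : ℕ} (hm : m < r) (hkm : k ≤ m) (hkn : k < n)
    (e : Fin r →₀ ℕ) :
    (∃ b : Fin r, b.val < m ∧ e b ≠ 0) ↔ ∃ s ∈ quadricExponents r n m k,
      s ≤ Finsupp.single ⟨k, hkm.trans_lt hm⟩ 1 + Finsupp.single ⟨m, hm⟩ 1 + e := by
  constructor
  · rintro ⟨b, hb, he⟩
    have hbe : Finsupp.single b 1 ≤ e := Finsupp.single_le_iff.mpr (Nat.one_le_iff_ne_zero.mpr he)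
    -- For `k < m` the divisor is `x_b x_k`, from an earlier layer. For `k = m` it is `x_b x_m`,
    -- already present in the current layer since `b < k`.
    rcases hkm.lt_or_eq with h | rfl
    · rcases le_total b ⟨k, hkm.trans_lt hm⟩ with hbk | hbk
      · refine ⟨_, ⟨b, ⟨k, hkm.trans_lt hm⟩, ?_, hbk, Or.inl h, rfl⟩, ?_⟩
        · rw [Fin.le_def] at hbk
          exact lt_of_le_of_lt hbk hkn
        · rw [add_comm]
          exact add_le_add le_self_add hbe
      · exact ⟨_, ⟨⟨k, hkm.trans_lt hm⟩, b, hkn, hbk, Or.inl hb, rfl⟩,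
          add_le_add le_self_add hbe⟩
    · refine ⟨_, ⟨b, ⟨k, hm⟩, by omega, Fin.le_def.mpr hb.le, Or.inr ⟨rfl, hb⟩, rfl⟩, ?_⟩
      rw [add_comm]
      exact add_le_add le_self_add hbe
  · rintro ⟨_, ⟨a, b, h1, h2, h3, rfl⟩, hle⟩
    -- If `e` involves no variable below `m`, the product has at most `x_k`, once, below `m`. An
    -- earlier layer's generator needs two such factors; one from the current layer needs some `x_a`
    -- with `a < k`.
    by_contra! hcon
    rw [Fin.le_def] at h2
    have ha := hle a
    have hb := hle b
    have ea := hcon a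
    have eb := hcon b
    simp only [Finsupp.add_apply, Finsupp.single_apply, Fin.ext_iff] at ha hb
    split_ifs at ha hb <;> omega

theorem hasLinearBetti_quadric_aux {n m : ℕ} (hm : m < r) {b : ℕ → ℕ}
    (h : HasLinearBetti (monomialIdeal K (quadricExponents r n m 0)) 2 b) (k : ℕ)
    (hkm : k ≤ m + 1) (hkn : k ≤ n) :
    HasLinearBetti (monomialIdeal K (quadricExponents r n m k)) 2
      fun i => b i + k * m.choose i := by
  induction k with
  | zero => simpa using h
  | succ k ih =>
    rw [quadricExponents_succ hm (by omega) (by omega), monomialIdeal_insert]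
    have := HasLinearBetti.cone
      (f := monomial (Finsupp.single ⟨k, by omega⟩ 1 + Finsupp.single ⟨m, hm⟩ 1) 1)
      (monomialIdeal_isHomogeneous _) ?_ ?_
      (ih (by omega) (by omega)) (hasLinearBetti_variableIdeal m hm.le)
    · convert this using 2 with i
      ring
    · exact isHomogeneous_monomial 1 (by rw [map_add, Finsupp.degree_single, Finsupp.degree_single])
    · intro p
      rw [monomial_mul_mem_monomialIdeal, mem_variableIdeal]
      exact forall₂_congr fun e _ => quadricExponents_colon hm (by omega) (by omega) e

theorem hasLinearBetti_quadric (n m : ℕ) (hm : m ≤ r) :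
    HasLinearBetti (monomialIdeal K (quadricExponents r n m 0)) 2
      fun i => ∑ j ∈ Finset.range m, min (j + 1) n * j.choose i := by
  induction m with
  | zero =>
    have h : monomialIdeal K (quadricExponents r n 0 0) = ⊥ := by
      simp [monomialIdeal, quadricExponents]
    rw [h]
    simpa using hasLinearBetti_bot 2
  | succ m ih =>
    rw [quadricExponents_succ_zero]
    simp only [Finset.sum_range_succ]
    exact hasLinearBetti_quadric_aux hm (ih (by omega)) _ (min_le_left _ _) (min_le_right _ _)

theorem quadricGenerators_eq (n : ℕ) :
    quadricGenerators K n r =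
      (fun s => monomial s (1 : K)) '' quadricExponents r n r 0 := by
  have hX : ∀ a b : Fin r, (X a * X b : MvPolynomial (Fin r) K) =
      monomial (Finsupp.single a 1 + Finsupp.single b 1) 1 := fun a b => by
    rw [X, X, monomial_mul, one_mul]
  ext p
  constructor
  · rintro (⟨a, b, ha, hb, rfl⟩ | ⟨a, b, ha, hb, rfl⟩)
    · rcases le_total a b with h | h
      · exact ⟨_, ⟨a, b, ha, h, Or.inl b.2, rfl⟩, (hX a b).symm⟩
      · exact ⟨_, ⟨b, a, hb, h, Or.inl a.2, rfl⟩, by rw [mul_comm]; exact (hX b a).symm⟩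
    · exact ⟨_, ⟨a, b, ha, Fin.le_def.mpr (by omega), Or.inl b.2, rfl⟩, (hX a b).symm⟩
  · rintro ⟨_, ⟨a, b, ha, -, -, rfl⟩, rfl⟩
    rcases lt_or_ge b.val n with h | h
    · exact Or.inl ⟨a, b, ha, h, (hX a b).symm⟩
    · exact Or.inr ⟨a, b, ha, h, (hX a b).symm⟩

/-- All generators are monomials of degree 2, and a monomial dividing another of the same degree
equals it. -/
theorem notMem_span_quadricGenerators_diff (n : ℕ) (g : MvPolynomial (Fin r) K)
    (hg : g ∈ quadricGenerators K n r) :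
    g ∉ Ideal.span (quadricGenerators K n r \ {g}) := by
  rw [quadricGenerators_eq] at hg ⊢
  obtain ⟨s, hs, rfl⟩ := hg
  have hinj : Function.Injective fun s : Fin r →₀ ℕ => monomial s (1 : K) :=
    monomial_left_injective one_ne_zero
  rw [show ({monomial s 1} : Set (MvPolynomial (Fin r) K)) =
      (fun s => monomial s (1 : K)) '' {s} by rw [Set.image_singleton], ← Set.image_sdiff hinj,
    mem_ideal_span_monomial_image]
  intro h
  obtain ⟨s', ⟨hs', hne⟩, hle⟩ := h s (by simp)
  obtain ⟨a, b, -, -, -, rfl⟩ := hs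
  obtain ⟨a', b', -, -, -, rfl⟩ := hs'
  obtain ⟨u, hu⟩ := le_iff_exists_add.mp hle
  have hdeg := congrArg Finsupp.degree hu
  simp only [map_add, Finsupp.degree_single] at hdeg
  have hu0 : u = 0 := (Finsupp.degree_eq_zero_iff u).mp (by omega)
  rw [hu0, add_zero] at hu
  exact hne hu.symm

end MonomialIdeals

/-! ### Closed form of the binomial sum -/

theorem sum_min_mul_choose_of_le {n m : ℕ} (i : ℕ) (h : m ≤ n) :
    ∑ j ∈ Finset.range m, min (j + 1) n * j.choose i = (i + 1) * (m + 1).choose (i + 2) := by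
  induction m with
  | zero => simp [Nat.choose_eq_zero_of_lt]
  | succ m ih =>
    -- Absorption `(m + 1) C(m, i) = (i + 1) C(m + 1, i + 1)` turns the sum into a hockey stick.
    rw [Finset.sum_range_succ, ih (by omega), min_eq_left h, Nat.add_one_mul_choose_eq,
      Nat.choose_succ_succ (m + 1) (i + 1)]
    ring

/-- Beyond `j = n` the weight is constantly `n`, and `∑ C(j, i)` over `n ≤ j < r` telescopes to the
difference of binomials. -/
theorem sum_min_mul_choose {n r : ℕ} (i : ℕ) (h : n ≤ r) :
    ((∑ j ∈ Finset.range r, min (j + 1) n * j.choose i : ℕ) : ℤ) =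
      (i + 1 : ℤ) * (n + 1).choose (i + 2) + n * (r.choose (i + 1) - n.choose (i + 1)) := by
  induction r, h using Nat.le_induction with
  | base => rw [sum_min_mul_choose_of_le i le_rfl]; push_cast; ring
  | succ r hr ih =>
    rw [Finset.sum_range_succ, Nat.cast_add, ih, min_eq_right (by omega),
      Nat.choose_succ_succ r i]
    push_cast
    ring

end

theorem mainTheorem6 {K : Type*} [Field K] (n r : ℕ) (hn : 1 ≤ n) (hnr : n < r) :
    (∀ g ∈ quadricGenerators K n r, g ∉ Ideal.span (quadricGenerators K n r \ {g})) ∧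
    HasLinearResolution (quadricIdeal K n r) 2 ∧
    ∃ β : ℕ → ℤ → ℕ, AreGradedBettiNumbers (quadricIdeal K n r) β ∧
      β 0 0 = 1 ∧
      (∀ i : ℕ, (β i ((i : ℤ) + 1) : ℤ) =
        (i : ℤ) * ((n + 1).choose (i + 1) : ℤ) +
          (n : ℤ) * ((r.choose i : ℤ) - (n.choose i : ℤ))) ∧
      (∀ (i : ℕ) (j : ℤ), j ≠ (i : ℤ) + 1 → ¬ (i = 0 ∧ j = 0) → β i j = 0) := by
  have hJ : quadricIdeal K n r = monomialIdeal K (quadricExponents r n r 0) := by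
    rw [quadricIdeal, quadricGenerators_eq]
    rfl
  rw [hJ]
  obtain ⟨F, hmin, h0, hd0, h⟩ :=
    HasLinearBetti.exists_graded (hasLinearBetti_quadric (K := K) n r le_rfl)
  refine ⟨notMem_span_quadricGenerators_diff n, ⟨F, hmin, h0, hd0, fun i => (h i).2⟩,
    fun i j => Module.finrank K (F.degreePart i j), ⟨⟨F⟩, fun G i j => ?_⟩, ?_, fun i => ?_,
    fun i j hj hij => ?_⟩
  · rw [GradedFreeResolution.finrank_tor_eq (monomialIdeal_isHomogeneous _) G F,
      F.finrank_tor_of_isMinimal hmin]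
  · beta_reduce
    rw [F.finrank_degreePart_of_eq hd0, h0]
  · beta_reduce
    cases i with
    | zero =>
      -- The basis of `F_0` lies in degree 0, so degree 1 contributes nothing; the formula agrees,
      -- since `C(r, 0) = C(n, 0)`.
      rw [F.finrank_degreePart_of_ne fun a => by rw [hd0]; simp]
      simp
    | succ i =>
      rw [F.finrank_degreePart_of_eq fun a => by rw [(h i).2]; push_cast; ring, (h i).1,
        sum_min_mul_choose i hnr.le]
      push_cast
      ring
  · refine F.finrank_degreePart_of_ne fun a => ?_
    cases i with
    | zero =>
      rw [hd0]
      exact fun h' => hij ⟨rfl, h'.symm⟩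
    | succ i =>
      rw [(h i).2]
      push_cast at hj ⊢
      exact fun h' => hj (by rw [← h']; ring)
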